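/- An $n\times n$ integer matrix $A$ ($n\ge 1$) is a dilation matrix if all its complex eigenvalues $\lambda$ satisfy $|\lambda|>1$. A multiresolution analysis associated with a dilation matrix $B$ is a nested sequence $\cdots\subset V_{-1}\subset V_0\subset V_1\subset\cdots$ of closed subspaces of $L^2(\mathbb{R}^n)$ such that 1. $\overline{\bigcup_{j\in\mathbb{Z}}V_j}=L^2(\mathbb{R}^n)$; 2. $\bigcap_{j\in\mathbb{Z}}V_j=\{0\}$; 3. for all $j\in\mathbb{Z}$: $f(x)\in V_j$ if and only if $f(Bx)\in V_{j+1}$; 4. for all $k\in\mathbb{Z}^n$: $f(x)\in V_0$ if and only if $f(x-k)\in V_0$; 5. there is a function $\phi\in V_0$, called a scaling function, such that $\{\phi(x-k):k\in\mathbb{Z}^n\}$ is a complete orthonormal basis of $V_0$. A scaling function is Haar-like if it is the characteristic function of a measurable subset of $\mathbb{R}^n$. **Theorem.** Let $n\ge 1$ and let $A$ be an $n\times n$ dilation matrix. Then there is an integer $\beta\ge 1$ such that, for all integers $k\ge\beta$, the matrix $A^k$ is a dilation matrix whose smallest singular value is greater than $2$, and there exists a multiresolution analysis associated with the dilation matrix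 $A^k$ that has a Haar-like scaling function. -/

import Mathlib

open MeasureTheory

/-- A dilation matrix for `ℤⁿ`: an `n × n` integer matrix all of whose (complex) eigenvalues
have absolute value greater than `1`. -/
def IsDilationMatrix {n : ℕ} (A : Matrix (Fin n) (Fin n) ℤ) : Prop :=
  ∀ z : ℂ, Module.End.HasEigenvalue (Matrix.toLin' (A.map (Int.cast : ℤ → ℂ))) z → 1 < ‖z‖

/-- The complex Hilbert space `L²(ℝⁿ)` with respect to Lebesgue measure. (The norm that Lean puts
on the domain `Fin n → ℝ` plays no role; only its Lebesgue measure is used.) -/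
abbrev L2Space (n : ℕ) : Type :=
  Lp ℂ 2 (volume : Measure (Fin n → ℝ))

/-- The function `f` on `ℝⁿ` is square integrable and its class in `L²(ℝⁿ)` lies in `V`. -/
def FunMem {n : ℕ} (f : (Fin n → ℝ) → ℂ) (V : Submodule ℂ (L2Space n)) : Prop :=
  ∃ hf : MemLp f 2 (volume : Measure (Fin n → ℝ)), hf.toLp f ∈ V

/-- The linear action `x ↦ A x` of an integer matrix on `ℝⁿ`. -/
def matAct {n : ℕ} (A : Matrix (Fin n) (Fin n) ℤ) (x : Fin n → ℝ) : Fin n → ℝ :=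
  (A.map (Int.cast : ℤ → ℝ)).mulVec x

/-- The integer intTranslate `x ↦ f (x - k)`, for `k ∈ ℤⁿ`. -/
def intTranslate {n : ℕ} (f : (Fin n → ℝ) → ℂ) (k : Fin n → ℤ) : (Fin n → ℝ) → ℂ :=
  fun x => f (fun i => x i - (k i : ℝ))

/-- `φ` is a scaling function for the space `V₀`: the integer translates `φ(x - k)`, `k ∈ ℤⁿ`,
form a complete orthonormal basis of `V₀`. (In particular, for `k = 0`, `φ ∈ V₀`.) -/
def IsScalingFunction {n : ℕ} (V₀ : Submodule ℂ (L2Space n)) (φ : (Fin n → ℝ) → ℂ) : Prop :=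
  ∃ b : HilbertBasis (Fin n → ℤ) ℂ V₀,
    ∀ k : Fin n → ℤ, ((b k : L2Space n) : (Fin n → ℝ) → ℂ) =ᵐ[volume] intTranslate φ k

/-- `(V j)`, `j ∈ ℤ`, is a multiresolution analysis of `L²(ℝⁿ)` associated with `A`. -/
structure IsMRA {n : ℕ} (A : Matrix (Fin n) (Fin n) ℤ) (V : ℤ → Submodule ℂ (L2Space n)) :
    Prop where
  isClosed : ∀ j, IsClosed (V j : Set (L2Space n))
  nested : ∀ j, V j ≤ V (j + 1)
  dense : closure (⋃ j, (V j : Set (L2Space n))) = Set.univ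
  inter : ⨅ j, V j = ⊥
  dilation : ∀ (j : ℤ) (f : (Fin n → ℝ) → ℂ),
    FunMem f (V j) ↔ FunMem (fun x => f (matAct A x)) (V (j + 1))
  translation : ∀ (f : (Fin n → ℝ) → ℂ) (k : Fin n → ℤ),
    FunMem f (V 0) ↔ FunMem (intTranslate f k) (V 0)
  exists_scaling : ∃ φ, IsScalingFunction (V 0) φ

/-- A function is Haar-like if it is the characteristic function of a measurable set. -/
def IsHaarLike {n : ℕ} (φ : (Fin n → ℝ) → ℂ) : Prop :=
  ∃ Q : Set (Fin n → ℝ), MeasurableSet Q ∧ φ = Q.indicator (fun _ => 1)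

/-! The eigenvalues of the inverse of `A` lie inside the unit disc, so its powers tend to zero. For
all large k the matrix B = A^k therefore expands both the Euclidean and the sup norm by a factor of
at least 3. The Euclidean bound gives singular values above 2; the sup bound makes division with
remainder by B work on integer vectors.

The remainders (`digits`) are the integer points that B⁻¹ sends into the half-open unit cube centred
at 0. They represent each class modulo B once, so there are |det B| of them (`card_digits`). Since
rounding adds at most 1/2 and 1/3 + 1/2 < 1, repeated division brings every integer vector to 0
(`abs_quotVec_le`). Let T be the compact set of all sums of B^(-i) d_i, i ≥ 1, with digits d_i. Then
B T is the union of the translates T + d, and comparing volumes shows that these overlap only in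
null sets. Termination of the division extends this to all integer translates, which also cover
space, so T is a tile of measure 1 (`exists_isRefinableTile`).

Take V_j to be the L² functions that are constant on each B^(-j)(T + k). Nesting holds because the
tilings refine each other. The intersection is trivial because tile volumes grow without bound as j
→ -∞, and the union is dense because tile diameters shrink to 0 as j → ∞. The indicator of T is the
scaling function. -/

/-! ### Large powers of a dilation matrix are expanding. -/

section Asymptotics

open Filter Topology

/-- Powers of an element of a complex Banach algebra with spectral radius `< 1` tend to `0`. -/
theorem tendsto_pow_zero_of_forall_mem_spectrum_norm_lt_one {R : Type*} [NormedRing R]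
    [NormedAlgebra ℂ R] [CompleteSpace R] [Nontrivial R] {a : R}
    (ha : ∀ z ∈ spectrum ℂ a, ‖z‖ < 1) : Tendsto (fun k : ℕ => a ^ k) atTop (𝓝 0) := by
  have h1 : spectralRadius ℂ a < 1 := by
    have := spectrum.spectralRadius_lt_of_forall_lt (r := 1) a (fun z hz => by
      have := ha z hz
      exact_mod_cast this)
    simpa using this
  obtain ⟨r, hr0, hr1⟩ := ENNReal.lt_iff_exists_nnreal_btwn.1 h1
  have hr1' : r < 1 := by exact_mod_cast hr1
  -- Gelfand's formula: the k-th roots of the norms of `a ^ k` are eventually below `r < 1`.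
  have h2 := (spectrum.pow_nnnorm_pow_one_div_tendsto_nhds_spectralRadius a).eventually_lt_const hr0
  have h3 : ∀ᶠ k : ℕ in atTop, ‖a ^ k‖ ≤ (r : ℝ) ^ k := by
    filter_upwards [h2, eventually_ge_atTop 1] with k hk hk1
    have hk0 : (0 : ℝ) < k := by exact_mod_cast hk1
    have h4 := ENNReal.rpow_le_rpow hk.le hk0.le
    rw [← ENNReal.rpow_mul, one_div, inv_mul_cancel₀ hk0.ne', ENNReal.rpow_one,
      ENNReal.rpow_natCast] at h4
    exact_mod_cast h4
  exact squeeze_zero_norm' h3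
    (tendsto_pow_atTop_nhds_zero_of_lt_one r.2 (by exact_mod_cast hr1'))

theorem isDilationMatrix_iff_spectrum {n : ℕ} {A : Matrix (Fin n) (Fin n) ℤ} :
    IsDilationMatrix A ↔
      ∀ z ∈ spectrum ℂ (A.map (Int.cast : ℤ → ℂ)), 1 < ‖z‖ := by
  simp only [IsDilationMatrix, Module.End.hasEigenvalue_iff_mem_spectrum, Matrix.spectrum_toLin']

theorem Matrix.map_intCast_pow {n : ℕ} {R : Type*} [CommRing R] (A : Matrix (Fin n) (Fin n) ℤ)
    (k : ℕ) : (A ^ k).map (Int.cast : ℤ → R) = (A.map (Int.cast : ℤ → R)) ^ k :=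
  Matrix.map_pow A (Int.castRingHom R) k

theorem Matrix.det_map_intCast {n : ℕ} {R : Type*} [CommRing R]
    (A : Matrix (Fin n) (Fin n) ℤ) : (A.map (Int.cast : ℤ → R)).det = (A.det : R) :=
  ((Int.castRingHom R).map_det A).symm

theorem IsDilationMatrix.pow {n : ℕ} {A : Matrix (Fin n) (Fin n) ℤ} (hA : IsDilationMatrix A)
    {k : ℕ} (hk : k ≠ 0) : IsDilationMatrix (A ^ k) := by
  rw [isDilationMatrix_iff_spectrum] at hA ⊢
  intro z hz
  rw [Matrix.map_intCast_pow, spectrum.map_pow_of_pos _ (Nat.pos_of_ne_zero hk)] at hz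
  obtain ⟨w, hw, rfl⟩ := hz
  simpa using one_lt_pow₀ (hA w hw) hk

theorem IsDilationMatrix.det_ne_zero {n : ℕ} {A : Matrix (Fin n) (Fin n) ℤ}
    (hA : IsDilationMatrix A) : A.det ≠ 0 := by
  intro h
  rw [isDilationMatrix_iff_spectrum] at hA
  have h0 : (0 : ℂ) ∈ spectrum ℂ (A.map (Int.cast : ℤ → ℂ)) := by
    rw [spectrum.zero_mem_iff, Matrix.isUnit_iff_isUnit_det, Matrix.det_map_intCast, h]
    simp
  have := hA 0 h0
  rw [norm_zero] at this
  linarith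

/-- The spectrum of the inverse consists of reciprocals of eigenvalues, all of modulus below 1. The
spectral argument needs complex matrices; the limit is carried back to real ones entry by entry. -/
theorem IsDilationMatrix.tendsto_inv_pow {n : ℕ} (hn : 1 ≤ n) {A : Matrix (Fin n) (Fin n) ℤ}
    (hA : IsDilationMatrix A) :
    Tendsto (fun k : ℕ => ((A.map (Int.cast : ℤ → ℝ))⁻¹) ^ k) atTop (𝓝 0) := by
  let _ : NormedRing (Matrix (Fin n) (Fin n) ℂ) := Matrix.linftyOpNormedRing
  let _ : NormedAlgebra ℂ (Matrix (Fin n) (Fin n) ℂ) := Matrix.linftyOpNormedAlgebra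
  have : CompleteSpace (Matrix (Fin n) (Fin n) ℂ) := FiniteDimensional.complete ℂ _
  have : Nonempty (Fin n) := ⟨⟨0, hn⟩⟩
  have hdet := hA.det_ne_zero
  have hu : IsUnit (A.map (Int.cast : ℤ → ℂ)) := by
    rw [Matrix.isUnit_iff_isUnit_det, Matrix.det_map_intCast]
    exact isUnit_iff_ne_zero.2 (by exact_mod_cast hdet)
  obtain ⟨u, hu⟩ := hu
  have hspec : ∀ z ∈ spectrum ℂ ((↑u⁻¹ : Matrix (Fin n) (Fin n) ℂ)), ‖z‖ < 1 := by
    intro z hz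
    rw [← spectrum.map_inv, Set.mem_inv, hu] at hz
    have := isDilationMatrix_iff_spectrum.1 hA _ hz
    rw [norm_inv] at this
    exact (one_lt_inv_iff₀.1 this).2
  have hlim := tendsto_pow_zero_of_forall_mem_spectrum_norm_lt_one hspec
  set M := (A.map (Int.cast : ℤ → ℝ))⁻¹ with hM
  have hM1 : M * A.map (Int.cast : ℤ → ℝ) = 1 := by
    rw [hM]
    refine Matrix.nonsing_inv_mul _ ?_
    rw [Matrix.det_map_intCast]
    exact isUnit_iff_ne_zero.2 (by exact_mod_cast hdet)
  have hMc : M.map (Complex.ofRealHom) = (↑u⁻¹ : Matrix (Fin n) (Fin n) ℂ) := by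
    have h1 : M.map Complex.ofRealHom * (u : Matrix (Fin n) (Fin n) ℂ) = 1 := by
      have h2 : (u : Matrix (Fin n) (Fin n) ℂ)
          = (A.map (Int.cast : ℤ → ℝ)).map Complex.ofRealHom := by
        rw [hu]; ext i j; simp
      rw [h2, ← Matrix.map_mul, hM1]
      exact Matrix.map_one _ (map_zero _) (map_one _)
    exact (Units.inv_eq_of_mul_eq_one_left h1).symm
  refine tendsto_pi_nhds.2 fun i => tendsto_pi_nhds.2 fun j => ?_
  have h3 := (tendsto_pi_nhds.1 (tendsto_pi_nhds.1 hlim i) j).norm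
  rw [← hMc] at h3
  refine squeeze_zero_norm (fun k => le_of_eq ?_) (by simpa using h3)
  have h4 : M.map Complex.ofRealHom ^ k = (M ^ k).map Complex.ofRealHom :=
    (Matrix.map_pow M Complex.ofRealHom k).symm
  rw [h4]
  simp

/-- Applying a linear family of operators to a null sequence of matrices. -/
theorem eventually_norm_le_of_tendsto_zero {n : ℕ} {F : Type*} [NormedAddCommGroup F]
    [NormedSpace ℝ F] (Φ : Matrix (Fin n) (Fin n) ℝ →ₗ[ℝ] F)
    {M : ℕ → Matrix (Fin n) (Fin n) ℝ} (hM : Tendsto M atTop (𝓝 0)) {ε : ℝ} (hε : 0 < ε) :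
    ∀ᶠ k in atTop, ‖Φ (M k)‖ ≤ ε := by
  have h1 : Continuous Φ := Φ.continuous_of_finiteDimensional
  have h2 : Tendsto (fun k => ‖Φ (M k)‖) atTop (𝓝 0) := by
    simpa using ((h1.tendsto 0).comp hM).norm
  exact (h2.eventually_lt_const hε).mono fun _ h => h.le

/-- On an eigenvector v of T*T for σ², one has ‖T v‖ = σ ‖v‖, so a lower bound on T bounds every σ.
-/
theorem LinearMap.lt_singularValues {E F : Type*} [NormedAddCommGroup E] [InnerProductSpace ℝ E]
    [FiniteDimensional ℝ E] [NormedAddCommGroup F] [InnerProductSpace ℝ F]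
    [FiniteDimensional ℝ F] (T : E →ₗ[ℝ] F) {c : ℝ}
    (hT : ∀ x, x ≠ 0 → c * ‖x‖ < ‖T x‖) {i : ℕ} (hi : i < Module.finrank ℝ E) :
    c < T.singularValues i := by
  obtain ⟨v, hv⟩ := (T.hasEigenvalue_adjoint_comp_self_sq_singularValues hi).exists_hasEigenvector
  have h1 : ‖T v‖ ^ 2 = T.singularValues i ^ 2 * ‖v‖ ^ 2 := by
    rw [← real_inner_self_eq_norm_sq, ← LinearMap.adjoint_inner_left]
    have h2 := hv.apply_eq_smul
    simp only [LinearMap.comp_apply] at h2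
    rw [h2, inner_smul_left, real_inner_self_eq_norm_sq]
    simp
  rw [← mul_pow, sq_eq_sq₀ (norm_nonneg _)
    (mul_nonneg (T.singularValues_nonneg i) (norm_nonneg _))] at h1
  have h3 := hT v hv.2
  rw [h1] at h3
  exact lt_of_mul_lt_mul_right h3 (norm_nonneg _)

theorem IsDilationMatrix.exists_pow_expanding {n : ℕ} (hn : 1 ≤ n)
    {A : Matrix (Fin n) (Fin n) ℤ} (hA : IsDilationMatrix A) :
    ∃ β : ℕ, 1 ≤ β ∧ ∀ k : ℕ, β ≤ k →
      (∀ x : Fin n → ℝ, 3 * ‖x‖ ≤ ‖matAct (A ^ k) x‖) ∧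
      ∀ x : EuclideanSpace ℝ (Fin n),
        3 * ‖x‖ ≤ ‖Matrix.toEuclideanLin ((A ^ k).map (Int.cast : ℤ → ℝ)) x‖ := by
  have hlim := hA.tendsto_inv_pow hn
  -- The same null sequence is measured in two operator norms: sup norm here, for the tile, and
  -- Euclidean norm next, for the singular values. The bound 1/3 on the inverse becomes the
  -- expansion factor 3.
  have h1 := eventually_norm_le_of_tendsto_zero
    ((LinearMap.toContinuousLinearMap.toLinearMap).comp
      (Matrix.toLin' : Matrix (Fin n) (Fin n) ℝ ≃ₗ[ℝ] _).toLinearMap) hlim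
    (by norm_num : (0 : ℝ) < 1 / 3)
  have h2 := eventually_norm_le_of_tendsto_zero
    ((LinearMap.toContinuousLinearMap.toLinearMap).comp
      (Matrix.toEuclideanLin : Matrix (Fin n) (Fin n) ℝ ≃ₗ[ℝ] _).toLinearMap) hlim
    (by norm_num : (0 : ℝ) < 1 / 3)
  obtain ⟨β, hβ⟩ := eventually_atTop.1 (h1.and h2)
  refine ⟨max β 1, le_max_right _ _, fun k hk => ?_⟩
  obtain ⟨h3, h4⟩ := hβ k ((le_max_left _ _).trans hk)
  have hinv : ((A.map (Int.cast : ℤ → ℝ))⁻¹) ^ k * (A ^ k).map (Int.cast : ℤ → ℝ) = 1 := by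
    rw [Matrix.inv_pow', ← Matrix.map_intCast_pow]
    refine Matrix.nonsing_inv_mul _ ?_
    rw [Matrix.det_map_intCast, Matrix.det_pow, Int.cast_pow]
    exact isUnit_iff_ne_zero.2 (pow_ne_zero _ (by exact_mod_cast hA.det_ne_zero))
  constructor
  · intro x
    have h5 := ContinuousLinearMap.le_of_opNorm_le _ h3 (matAct (A ^ k) x)
    have h6 : ((A.map (Int.cast : ℤ → ℝ))⁻¹ ^ k).mulVec (matAct (A ^ k) x) = x := by
      rw [matAct, Matrix.mulVec_mulVec, hinv, Matrix.one_mulVec]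
    simp only [LinearMap.comp_apply, LinearEquiv.coe_coe, LinearMap.coe_toContinuousLinearMap',
      Matrix.toLin'_apply, h6] at h5
    linarith
  · intro x
    have h5 := ContinuousLinearMap.le_of_opNorm_le _ h4
      (Matrix.toEuclideanLin ((A ^ k).map (Int.cast : ℤ → ℝ)) x)
    have h6 : Matrix.toEuclideanLin ((A.map (Int.cast : ℤ → ℝ))⁻¹ ^ k)
        (Matrix.toEuclideanLin ((A ^ k).map (Int.cast : ℤ → ℝ)) x) = x := by
      rw [Matrix.toLpLin_apply, Matrix.toLpLin_apply, Matrix.mulVec_mulVec, hinv,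
        Matrix.one_mulVec]
    simp only [LinearMap.comp_apply, LinearEquiv.coe_coe, LinearMap.coe_toContinuousLinearMap',
      h6] at h5
    linarith

end Asymptotics

/-! ### Division with remainder on integer vectors, and the self-affine set. -/

section Tile

open Filter Topology Set

variable {n : ℕ}

/-- The integer vector `k`, seen in `ℝⁿ`. -/
def intVec (k : Fin n → ℤ) : Fin n → ℝ := fun i => (k i : ℝ)

theorem intVec_zero : intVec (0 : Fin n → ℤ) = 0 := by ext; simp [intVec]

theorem intVec_add (k l : Fin n → ℤ) : intVec (k + l) = intVec k + intVec l := by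
  ext; simp [intVec]

theorem intVec_sub (k l : Fin n → ℤ) : intVec (k - l) = intVec k - intVec l := by
  ext; simp [intVec]

theorem matAct_intVec (B : Matrix (Fin n) (Fin n) ℤ) (k : Fin n → ℤ) :
    matAct B (intVec k) = intVec (B.mulVec k) := by
  ext i; simp [matAct, intVec, Matrix.mulVec, dotProduct]

theorem isClosed_range_intVec : IsClosed (range (intVec (n := n))) := by
  have : range (intVec (n := n)) = Set.pi univ fun _ => range (Int.cast : ℤ → ℝ) := by
    ext x
    simp only [mem_range, Set.mem_pi, mem_univ, true_implies]
    constructor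
    · rintro ⟨k, rfl⟩ i
      exact ⟨k i, rfl⟩
    · intro h
      choose k hk using h
      exact ⟨k, funext hk⟩
  rw [this]
  exact isClosed_set_pi fun _ _ => Int.isClosedEmbedding_coe_real.isClosed_range

/-- The integer vector closest to `x`. -/
noncomputable def roundVec (x : Fin n → ℝ) : Fin n → ℤ := fun i => ⌊x i + 1 / 2⌋

theorem abs_sub_roundVec_le (x : Fin n → ℝ) (i : Fin n) : |x i - roundVec x i| ≤ 1 / 2 := by
  have h1 := Int.floor_le (x i + 1 / 2)
  have h2 := Int.lt_floor_add_one (x i + 1 / 2)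
  rw [abs_le, roundVec]
  constructor <;> linarith

theorem norm_sub_roundVec_le (x : Fin n → ℝ) : ‖x - intVec (roundVec x)‖ ≤ 1 / 2 :=
  (pi_norm_le_iff_of_nonneg (by norm_num)).2 fun i => abs_sub_roundVec_le x i

theorem roundVec_intVec_add (k : Fin n → ℤ) (x : Fin n → ℝ) :
    roundVec (intVec k + x) = k + roundVec x := by
  ext i
  simp only [roundVec, intVec, Pi.add_apply, add_assoc]
  exact Int.floor_intCast_add _ _

/-- `L` is the linear automorphism of `ℝⁿ` given by an integer matrix `B`, and expands the sup norm
by a factor of at least `3`. -/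
structure IsExpandingAction (B : Matrix (Fin n) (Fin n) ℤ) (L : (Fin n → ℝ) ≃L[ℝ] (Fin n → ℝ)) :
    Prop where
  apply_eq : ∀ x, L x = matAct B x
  expand : ∀ x, 3 * ‖x‖ ≤ ‖L x‖

theorem exists_isExpandingAction {B : Matrix (Fin n) (Fin n) ℤ}
    (hB : ∀ x, 3 * ‖x‖ ≤ ‖matAct B x‖) : ∃ L, IsExpandingAction B L := by
  have hinj : Function.Injective (Matrix.mulVecLin (B.map (Int.cast : ℤ → ℝ))) := by
    rw [injective_iff_map_eq_zero]
    intro x hx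
    have h1 := hB x
    rw [matAct, ← Matrix.mulVecLin_apply, hx, norm_zero] at h1
    exact norm_le_zero_iff.1 (by linarith)
  exact ⟨(LinearEquiv.ofInjectiveEndo _ hinj).toContinuousLinearEquiv, fun x => rfl, hB⟩

namespace IsExpandingAction

variable {B : Matrix (Fin n) (Fin n) ℤ} {L : (Fin n → ℝ) ≃L[ℝ] (Fin n → ℝ)}

theorem apply_intVec (h : IsExpandingAction B L) (k : Fin n → ℤ) :
    L (intVec k) = intVec (B.mulVec k) := by
  rw [h.apply_eq, matAct_intVec]

theorem norm_symm_le (h : IsExpandingAction B L) (x : Fin n → ℝ) : ‖L.symm x‖ ≤ 1 / 3 * ‖x‖ := by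
  have := h.expand (L.symm x)
  rw [L.apply_symm_apply] at this
  linarith

end IsExpandingAction

/-- The quotient in the division of the integer vector `m` by the matrix of `L`. -/
noncomputable def quotVec (L : (Fin n → ℝ) ≃L[ℝ] (Fin n → ℝ)) (m : Fin n → ℤ) : Fin n → ℤ :=
  roundVec (L.symm (intVec m))

/-- The remainders in the division of integer vectors by the matrix of `L`. -/
def digits (L : (Fin n → ℝ) ≃L[ℝ] (Fin n → ℝ)) : Set (Fin n → ℤ) := {d | quotVec L d = 0}

namespace IsExpandingAction

variable {B : Matrix (Fin n) (Fin n) ℤ} {L : (Fin n → ℝ) ≃L[ℝ] (Fin n → ℝ)}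

theorem quotVec_mulVec_add (h : IsExpandingAction B L) (k m : Fin n → ℤ) :
    quotVec L (B.mulVec k + m) = k + quotVec L m := by
  rw [quotVec, intVec_add, map_add, ← h.apply_intVec, L.symm_apply_apply, roundVec_intVec_add]
  rfl

theorem exists_digit (h : IsExpandingAction B L) (m : Fin n → ℤ) :
    ∃ d ∈ digits L, m = B.mulVec (quotVec L m) + d := by
  refine ⟨m - B.mulVec (quotVec L m), ?_, by abel⟩
  have h1 := h.quotVec_mulVec_add (-quotVec L m) m
  rw [Matrix.mulVec_neg, neg_add_eq_sub, neg_add_cancel] at h1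
  exact h1

/-- Descent that makes repeated division terminate: (N + 1)/3 + 1/2 < N + 1 already at N = 0, and
integrality turns the strict bound into N. An expansion factor of 2 would not suffice for this
estimate. -/
theorem abs_quotVec_le (h : IsExpandingAction B L) {m : Fin n → ℤ} {N : ℕ}
    (hm : ∀ i, |m i| ≤ N + 1) (i : Fin n) : |quotVec L m i| ≤ N := by
  have h1 : ‖intVec m‖ ≤ N + 1 :=
    (pi_norm_le_iff_of_nonneg (by positivity)).2 fun j => by
      have := hm j
      rw [intVec, Real.norm_eq_abs]
      exact_mod_cast this
  have h2 := h.norm_symm_le (intVec m)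
  have h3 := norm_le_pi_norm (L.symm (intVec m)) i
  rw [Real.norm_eq_abs] at h3
  have h4 := abs_sub_roundVec_le (L.symm (intVec m)) i
  have h5 : |(quotVec L m i : ℝ)| < N + 1 := by
    have h6 := abs_sub_abs_le_abs_sub ((quotVec L m i : ℝ)) (L.symm (intVec m) i)
    rw [abs_sub_comm] at h6
    have : (0 : ℝ) ≤ N := by positivity
    change |L.symm (intVec m) i - quotVec L m i| ≤ 1 / 2 at h4
    linarith
  have h7 : |quotVec L m i| < N + 1 := by exact_mod_cast h5
  omega

theorem zero_mem_digits (L : (Fin n → ℝ) ≃L[ℝ] (Fin n → ℝ)) : (0 : Fin n → ℤ) ∈ digits L := by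
  ext i
  rw [quotVec, intVec_zero, map_zero, roundVec]
  norm_num

theorem single_mem_digits (h : IsExpandingAction B L) (i : Fin n) : Pi.single i 1 ∈ digits L := by
  ext j
  have := h.abs_quotVec_le (m := Pi.single i 1) (N := 0) (fun l => by
    by_cases hl : l = i
    · subst hl; simp
    · simp [hl]) j
  simpa using this

theorem injective_mulVecLin (h : IsExpandingAction B L) :
    Function.Injective (Matrix.mulVecLin B) := by
  intro k l hkl
  have h1 : intVec k = intVec l := L.injective (by
    rw [h.apply_intVec, h.apply_intVec]
    exact congrArg intVec hkl)
  ext i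
  have h2 : (k i : ℝ) = l i := congrFun h1 i
  exact_mod_cast h2

/-- The image lattice of B has index |det B|, and each of its cosets contains exactly one digit:
division supplies one, and two congruent digits have quotients differing by the vector that relates
them, hence coincide. -/
theorem card_digits (h : IsExpandingAction B L) : Nat.card (digits L) = B.det.natAbs := by
  set N := LinearMap.range (Matrix.mulVecLin B)
  have h1 := Submodule.natAbs_det_equiv N (LinearEquiv.ofInjective _ h.injective_mulVecLin)
  have h2 : N.subtype ∘ₗ AddMonoidHom.toIntLinearMap
      ((LinearEquiv.ofInjective _ h.injective_mulVecLin : _ ≃ₗ[ℤ] N) : (Fin n → ℤ) →+ N)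
      = Matrix.toLin' B := by
    ext; rfl
  rw [h2, LinearMap.det_toLin'] at h1
  rw [h1]
  refine Nat.card_congr (Equiv.ofBijective (fun d : digits L => N.mkQ d) ⟨?_, ?_⟩)
  · rintro ⟨d, hd⟩ ⟨e, he⟩ hde
    have h3 : d - e ∈ N := (Submodule.Quotient.eq N).1 hde
    obtain ⟨k, hk⟩ := h3
    have h4 : d = B.mulVec k + e := by
      rw [Matrix.mulVecLin_apply] at hk
      rw [hk]; abel
    have h5 := h.quotVec_mulVec_add k e
    rw [← h4, show quotVec L d = 0 from hd, show quotVec L e = 0 from he, add_zero] at h5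
    simp [h4, ← h5]
  · intro x
    obtain ⟨m, rfl⟩ := N.mkQ_surjective x
    obtain ⟨d, hd, hm⟩ := h.exists_digit m
    refine ⟨⟨d, hd⟩, (Submodule.Quotient.eq N).2 ⟨-quotVec L m, ?_⟩⟩
    rw [Matrix.mulVecLin_apply, Matrix.mulVec_neg]
    nth_rw 2 [hm]
    abel

theorem det_eq (h : IsExpandingAction B L) :
    LinearMap.det (L : (Fin n → ℝ) →ₗ[ℝ] (Fin n → ℝ)) = B.det := by
  have : (L : (Fin n → ℝ) →ₗ[ℝ] (Fin n → ℝ)) = Matrix.toLin' (B.map (Int.cast : ℤ → ℝ)) :=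
    LinearMap.ext fun x => h.apply_eq x
  rw [this, LinearMap.det_toLin', Matrix.det_map_intCast]

theorem det_ne_zero (h : IsExpandingAction B L) : B.det ≠ 0 := by
  have h1 := (LinearEquiv.isUnit_det' L.toLinearEquiv).ne_zero
  intro h0
  apply h1
  have := h.det_eq
  rw [h0, Int.cast_zero] at this
  exact this

theorem finite_digits (h : IsExpandingAction B L) : Finite (digits L) :=
  Nat.finite_of_card_ne_zero (by rw [h.card_digits]; simpa using h.det_ne_zero)

/-- The zero vector and a standard basis vector are two distinct digits. -/
theorem two_le_natAbs_det (h : IsExpandingAction B L) (hn : 1 ≤ n) : 2 ≤ B.det.natAbs := by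
  have := h.finite_digits
  rw [← h.card_digits]
  have : Nontrivial (digits L) := by
    refine ⟨⟨0, zero_mem_digits L⟩, ⟨_, h.single_mem_digits ⟨0, hn⟩⟩, fun h0 => ?_⟩
    have := congrFun (congrArg Subtype.val h0) ⟨0, hn⟩
    simp at this
  exact Finite.one_lt_card

theorem volume_image (h : IsExpandingAction B L) (s : Set (Fin n → ℝ)) :
    volume (L '' s) = (B.det.natAbs : ENNReal) * volume s := by
  rw [Measure.addHaar_image_continuousLinearEquiv, h.det_eq, ← Int.cast_abs, Int.abs_eq_natAbs,
    Int.cast_natCast, ENNReal.ofReal_natCast]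

/-- The point of `ℝⁿ` with a given radix expansion in base `L`. -/
noncomputable def radixPoint (L : (Fin n → ℝ) ≃L[ℝ] (Fin n → ℝ)) (s : ℕ → digits L) : Fin n → ℝ :=
  ∑' i, ((L.symm : (Fin n → ℝ) →L[ℝ] (Fin n → ℝ)) ^ (i + 1)) (intVec (s i).1)

theorem norm_symm_pow_le (h : IsExpandingAction B L) (x : Fin n → ℝ) (i : ℕ) :
    ‖((L.symm : (Fin n → ℝ) →L[ℝ] (Fin n → ℝ)) ^ i) x‖ ≤ (1 / 3) ^ i * ‖x‖ := by
  induction i with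
  | zero => simp
  | succ i ih =>
    rw [pow_succ', mul_apply_eq_comp]
    refine (h.norm_symm_le _).trans ?_
    rw [pow_succ', mul_assoc]
    gcongr

theorem exists_radix_bound (h : IsExpandingAction B L) :
    ∃ u : ℕ → ℝ, Summable u ∧ ∀ (i : ℕ) (s : ℕ → digits L),
      ‖((L.symm : (Fin n → ℝ) →L[ℝ] (Fin n → ℝ)) ^ (i + 1)) (intVec (s i).1)‖ ≤ u i := by
  have := h.finite_digits
  obtain ⟨C, hC⟩ := (Set.finite_range fun d : digits L => ‖intVec d.1‖).bddAbove
  refine ⟨fun i => (1 / 3) ^ (i + 1) * C, ?_, fun i s => ?_⟩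
  · exact ((summable_nat_add_iff 1).2
      (summable_geometric_of_lt_one (by norm_num) (by norm_num))).mul_right C
  · refine (h.norm_symm_pow_le _ _).trans ?_
    exact mul_le_mul_of_nonneg_left (hC ⟨s i, rfl⟩) (by positivity)

theorem radixPoint_eq (h : IsExpandingAction B L) (s : ℕ → digits L) :
    radixPoint L s = L.symm (intVec (s 0).1 + radixPoint L fun i => s (i + 1)) := by
  obtain ⟨u, hu, hb⟩ := h.exists_radix_bound
  have hs := fun s => Summable.of_norm_bounded hu fun i => hb i s
  rw [radixPoint, (hs s).tsum_eq_zero_add, map_add, radixPoint]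
  congr 1
  rw [L.symm.map_tsum]
  refine tsum_congr fun i => ?_
  rw [pow_succ' _ (i + 1)]
  rfl

/-- Weierstrass M-test on a product of finite discrete spaces. That product is compact, so the set
of radix points is compact. -/
theorem continuous_radixPoint (h : IsExpandingAction B L) : Continuous (radixPoint L) := by
  obtain ⟨u, hu, hb⟩ := h.exists_radix_bound
  refine continuous_tsum (fun i => ?_) hu hb
  exact ((L.symm : (Fin n → ℝ) →L[ℝ] (Fin n → ℝ)) ^ (i + 1)).continuous.comp
    ((continuous_of_discreteTopology (f := fun d : digits L => intVec d.1)).comp (continuous_apply i))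

/-- The self-affine set with digit set `digits L` exists. -/
theorem exists_selfAffine (h : IsExpandingAction B L) :
    ∃ T : Set (Fin n → ℝ), IsCompact T ∧ 0 ∈ T ∧
      ∀ x, x ∈ T ↔ ∃ d ∈ digits L, L x - intVec d ∈ T := by
  have := h.finite_digits
  refine ⟨range (radixPoint L), isCompact_range h.continuous_radixPoint, ?_, fun x => ?_⟩
  · refine ⟨fun _ => ⟨0, zero_mem_digits L⟩, ?_⟩
    simp [radixPoint, intVec_zero]
  · constructor
    · rintro ⟨s, rfl⟩
      refine ⟨s 0, (s 0).2, fun i => s (i + 1), ?_⟩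
      rw [h.radixPoint_eq s]
      simp
    · rintro ⟨d, hd, s, hs⟩
      refine ⟨fun i => Nat.casesOn i ⟨d, hd⟩ s, ?_⟩
      rw [h.radixPoint_eq]
      simp [hs]

end IsExpandingAction

end Tile

/-! ### Integer translates of the self-affine set tile space. -/

section LatticeTile

open Filter Topology Set
open scoped Pointwise

/-- If the measures of finitely many sets add up to the measure of their union, then the sets are
almost everywhere disjoint. -/
theorem aedisjoint_of_sum_measure_le {α ι : Type*} [MeasurableSpace α] {μ : Measure α} [Fintype ι]
    {s : ι → Set α} (hs : ∀ i, MeasurableSet (s i)) (hfin : ∀ i, μ (s i) ≠ ⊤)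
    (hsum : ∑ i, μ (s i) ≤ μ (⋃ i, s i)) {i j : ι} (hij : i ≠ j) : AEDisjoint μ (s i) (s j) := by
  classical
  set R := ∑ l ∈ (Finset.univ.erase i).erase j, μ (s l) with hR
  have hji : j ∈ Finset.univ.erase i := Finset.mem_erase.2 ⟨hij.symm, Finset.mem_univ _⟩
  have h1 : ∑ l, μ (s l) = μ (s i) + (μ (s j) + R) := by
    rw [hR, Finset.add_sum_erase _ (fun l => μ (s l)) hji,
      Finset.add_sum_erase _ (fun l => μ (s l)) (Finset.mem_univ i)]
  have h2 : μ (⋃ l, s l) ≤ μ (s i ∪ s j) + R := by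
    have : (⋃ l, s l) ⊆ (s i ∪ s j) ∪ ⋃ l ∈ (Finset.univ.erase i).erase j, s l := by
      refine iUnion_subset fun l x hx => ?_
      by_cases hi : l = i
      · subst hi; exact Or.inl (Or.inl hx)
      by_cases hj : l = j
      · subst hj; exact Or.inl (Or.inr hx)
      · exact Or.inr (mem_iUnion₂.2 ⟨l, by simp [hi, hj], hx⟩)
    exact (measure_mono this).trans
      ((measure_union_le _ _).trans (add_le_add_right (measure_biUnion_finset_le _ _) _))
  have h3 := measure_union_add_inter (μ := μ) (s i) (hs j)
  have hRfin : R ≠ ⊤ := ENNReal.sum_ne_top.2 fun l _ => hfin l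
  have hU : μ (s i ∪ s j) ≠ ⊤ :=
    ((measure_union_le _ _).trans_lt (ENNReal.add_lt_top.2 ⟨(hfin i).lt_top, (hfin j).lt_top⟩)).ne
  have h4 : μ (s i ∪ s j) + R + μ (s i ∩ s j) ≤ μ (s i ∪ s j) + R + 0 := by
    calc μ (s i ∪ s j) + R + μ (s i ∩ s j) = ∑ l, μ (s l) := by
          rw [h1, ← add_assoc, ← h3]; ring
      _ ≤ μ (s i ∪ s j) + R + 0 := by rw [add_zero]; exact hsum.trans h2
  exact le_antisymm
    ((ENNReal.add_le_add_iff_left (ENNReal.add_ne_top.2 ⟨hU, hRfin⟩)).1 h4) bot_le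

variable {n : ℕ}

/-- The translate of `T` by the integer vector `k`. -/
def intShift (T : Set (Fin n → ℝ)) (k : Fin n → ℤ) : Set (Fin n → ℝ) := {x | x - intVec k ∈ T}

theorem volume_intShift (T : Set (Fin n → ℝ)) (k : Fin n → ℤ) :
    volume (intShift T k) = volume T := by
  rw [← measure_preimage_add_right volume (-intVec k) T]
  simp only [intShift, sub_eq_add_neg]
  rfl

theorem measurableSet_intShift {T : Set (Fin n → ℝ)} (hT : MeasurableSet T) (k : Fin n → ℤ) :
    MeasurableSet (intShift T k) :=
  (measurable_sub_const (intVec k)) hT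

theorem aedisjoint_intShift_add {T : Set (Fin n → ℝ)} (m : Fin n → ℤ) {d e : Fin n → ℤ}
    (h : AEDisjoint volume (intShift T d) (intShift T e)) :
    AEDisjoint volume (intShift T (m + d)) (intShift T (m + e)) := by
  have h1 := measure_preimage_add_right volume (-intVec m) (intShift T d ∩ intShift T e)
  rw [show volume (intShift T d ∩ intShift T e) = 0 from h] at h1
  refine measure_mono_null (fun x hx => ?_) h1
  simp only [intShift, intVec_add, ← sub_sub] at hx
  simp only [← sub_eq_add_neg]
  exact hx

/-- If the integer translates of `T` tile `ℝⁿ`, then `T` has measure `1`. -/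
theorem volume_eq_one_of_tiling {T : Set (Fin n → ℝ)} (hT : MeasurableSet T)
    (hcov : ∀ x, ∃ k, x ∈ intShift T k)
    (hdis : Pairwise (Function.onFun (AEDisjoint volume) (intShift T))) : volume T = 1 := by
  set F : Set (Fin n → ℝ) := Set.pi univ fun _ => Ico (0 : ℝ) 1 with hF
  have hFm : MeasurableSet F := MeasurableSet.univ_pi fun _ => measurableSet_Ico
  have hFv : volume F = 1 := by rw [hF, volume_pi_pi]; simp
  -- The unit cube F tiles as well. Cutting F by translates of T and T by translates of F yields the
  -- same pieces up to translation, so the volumes agree.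
  have h1 : volume F = ∑' k, volume (F ∩ intShift T k) := by
    rw [← measure_iUnion₀
      (fun k l hkl => (hdis hkl).mono inter_subset_right inter_subset_right)
      (fun k => (hFm.inter (measurableSet_intShift hT k)).nullMeasurableSet), ← inter_iUnion]
    congr 1
    exact (inter_eq_left.2 fun x _ => mem_iUnion.2 (hcov x)).symm
  have h2 : ∀ k, volume (F ∩ intShift T k) = volume ((fun x => x + intVec k) ⁻¹' F ∩ T) := by
    intro k
    rw [← measure_preimage_add_right volume (intVec k)]
    congr 1
    ext x
    simp [intShift]
  have h3 : volume T = ∑' k, volume ((fun x => x + intVec k) ⁻¹' F ∩ T) := by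
    rw [← measure_iUnion
      (fun k l hkl => ?_) (fun k => ((measurable_add_const (intVec k)) hFm).inter hT),
      ← iUnion_inter]
    · congr 1
      refine (inter_eq_right.2 fun x _ => mem_iUnion.2 ⟨fun i => -⌊x i⌋, fun i _ => ?_⟩).symm
      have h4 := Int.floor_le (x i)
      have h5 := Int.lt_floor_add_one (x i)
      simp only [Pi.add_apply, intVec, Int.cast_neg, mem_Ico]
      constructor <;> linarith
    · refine Set.disjoint_left.2 fun x hx hx' => hkl ?_
      ext i
      have h4 := hx.1 i trivial
      have h5 := hx'.1 i trivial
      simp only [Pi.add_apply, intVec, mem_Ico] at h4 h5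
      have h6 : ((k i : ℤ) : ℝ) < l i + 1 := by linarith
      have h7 : ((l i : ℤ) : ℝ) < k i + 1 := by linarith
      have h8 : k i < l i + 1 := by exact_mod_cast h6
      have h9 : l i < k i + 1 := by exact_mod_cast h7
      omega
  rw [h3, ← tsum_congr h2, ← h1, hFv]

/-- The compact set `T` tiles `ℝⁿ` by integer translations, and every integer translate of `T` is
contained in the image under `L` of an integer translate of `T`. -/
structure IsRefinableTile (L : (Fin n → ℝ) ≃L[ℝ] (Fin n → ℝ)) (T : Set (Fin n → ℝ)) : Prop where
  isCompact : IsCompact T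
  cover : ∀ x, ∃ k, x ∈ intShift T k
  refines : ∀ m, ∃ k, ∀ x, L x ∈ intShift T m → x ∈ intShift T k
  aedisjoint : Pairwise (Function.onFun (AEDisjoint volume) (intShift T))
  volume_eq : volume T = 1

theorem IsExpandingAction.exists_isRefinableTile {B : Matrix (Fin n) (Fin n) ℤ}
    {L : (Fin n → ℝ) ≃L[ℝ] (Fin n → ℝ)} (h : IsExpandingAction B L) :
    ∃ T, IsRefinableTile L T := by
  obtain ⟨T, hTc, hT0, hT⟩ := h.exists_selfAffine
  have hTm : MeasurableSet T := hTc.isClosed.measurableSet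
  have hLk : ∀ (x : Fin n → ℝ) (k d : Fin n → ℤ),
      L x - intVec (B.mulVec k + d) = L (x - intVec k) - intVec d := by
    intro x k d
    rw [map_sub, h.apply_intVec, intVec_add]; abel
  -- With m = B q + d, membership of L x in T + m says L (x - q) - d ∈ T, hence x - q ∈ T by
  -- self-affinity.
  have href : ∀ (m : Fin n → ℤ) (x), L x ∈ intShift T m → x ∈ intShift T (quotVec L m) := by
    intro m x hx
    obtain ⟨d, hd, hm⟩ := h.exists_digit m
    refine (hT _).2 ⟨d, hd, ?_⟩
    rw [intShift, mem_ofPred_eq, hm, hLk] at hx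
    exact hx
  have hcov : ∀ x, ∃ k, x ∈ intShift T k := by
    -- C is closed, and by refinement it is stable under the inverse of L. It contains the integer
    -- lattice because 0 ∈ T, hence all the lattices L^(-N) ℤⁿ, whose union is dense.
    set C := T + range (intVec (n := n)) with hC
    have hCc : IsClosed C := isClosed_range_intVec.add_left_of_isCompact hTc
    have hmem : ∀ x, x ∈ C ↔ ∃ k, x ∈ intShift T k := by
      intro x
      constructor
      · rintro ⟨t, ht, _, ⟨k, rfl⟩, rfl⟩
        exact ⟨k, by simpa [intShift] using ht⟩
      · rintro ⟨k, hk⟩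
        exact ⟨_, hk, _, ⟨k, rfl⟩, sub_add_cancel _ _⟩
    have hinv : ∀ (N : ℕ) (k : Fin n → ℤ),
        ((L.symm : (Fin n → ℝ) →L[ℝ] (Fin n → ℝ)) ^ N) (intVec k) ∈ C := by
      intro N
      induction N with
      | zero => exact fun k => ⟨0, hT0, _, ⟨k, rfl⟩, by simp⟩
      | succ N ih =>
        intro k
        obtain ⟨m, hm⟩ := (hmem _).1 (ih k)
        rw [pow_succ', mul_apply_eq_comp]
        exact (hmem _).2 ⟨_, href m _ (by simpa using hm)⟩
    intro x
    rw [← hmem, ← hCc.closure_eq, Metric.mem_closure_iff]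
    intro ε hε
    obtain ⟨N, hN⟩ := exists_pow_lt_of_lt_one hε (by norm_num : (1 / 3 : ℝ) < 1)
    have hinvN : ∀ (N : ℕ) (y : Fin n → ℝ), ((L.symm : (Fin n → ℝ) →L[ℝ] (Fin n → ℝ)) ^ N)
        (((L : (Fin n → ℝ) →L[ℝ] (Fin n → ℝ)) ^ N) y) = y := by
      intro N
      induction N with
      | zero => simp
      | succ N ih =>
        intro y
        rw [pow_succ', pow_succ, mul_apply_eq_comp, mul_apply_eq_comp, ih]
        simp
    set y := ((L : (Fin n → ℝ) →L[ℝ] (Fin n → ℝ)) ^ N) x with hy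
    refine ⟨_, hinv N (roundVec y), ?_⟩
    rw [dist_eq_norm]
    nth_rw 1 [← hinvN N x]
    rw [← map_sub]
    calc _ ≤ _ := h.norm_symm_pow_le _ _
      _ ≤ (1 / 3) ^ N * 1 :=
        mul_le_mul_of_nonneg_left ((norm_sub_roundVec_le y).trans (by norm_num)) (by positivity)
      _ < ε := by rwa [mul_one]
  have hbase : ∀ d ∈ digits L, ∀ e ∈ digits L, d ≠ e →
      AEDisjoint volume (intShift T d) (intShift T e) := by
    intro d hd e he hde
    have := h.finite_digits
    have : Fintype (digits L) := Fintype.ofFinite _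
    refine aedisjoint_of_sum_measure_le (s := fun d : digits L => intShift T d.1)
      (i := ⟨d, hd⟩) (j := ⟨e, he⟩) (fun d => measurableSet_intShift hTm d.1)
      (fun d => ?_) ?_ (fun h0 => hde (congrArg Subtype.val h0))
    · rw [volume_intShift]; exact hTc.measure_ne_top
    · have h1 : (⋃ d : digits L, intShift T d.1) = L '' T := by
        ext x
        simp only [mem_iUnion, mem_image]
        constructor
        · rintro ⟨d, hx⟩
          exact ⟨L.symm x, (hT _).2 ⟨d, d.2, by simpa [intShift] using hx⟩, by simp⟩
        · rintro ⟨y, hy, rfl⟩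
          obtain ⟨d, hd, hx⟩ := (hT _).1 hy
          exact ⟨⟨d, hd⟩, hx⟩
      -- The union of the digit translates is L T, of volume |det B| · vol T, which is exactly the
      -- sum of their volumes.
      rw [h1, h.volume_image, ← h.card_digits]
      simp [volume_intShift]
  -- Induction on the size of the entries, which drops by one at each division. Equal quotients
  -- leave a translate of two distinct digit tiles; distinct quotients put the overlap inside the
  -- L-image of a null set.
  have hdis : ∀ (N : ℕ) (k l : Fin n → ℤ), (∀ i, |k i| ≤ N) → (∀ i, |l i| ≤ N) → k ≠ l →
      AEDisjoint volume (intShift T k) (intShift T l) := by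
    intro N
    induction N with
    | zero =>
      intro k l hk hl hkl
      refine absurd (funext fun i => ?_) hkl
      have h1 := hk i
      have h2 := hl i
      rw [Nat.cast_zero, abs_nonpos_iff] at h1 h2
      rw [h1, h2]
    | succ N ih =>
      intro k l hk hl hkl
      obtain ⟨d, hd, hkd⟩ := h.exists_digit k
      obtain ⟨e, he, hle⟩ := h.exists_digit l
      by_cases hq : quotVec L k = quotVec L l
      · have hde : d ≠ e := by
          rintro rfl
          exact hkl (by rw [hkd, hle, hq])
        rw [hkd, hle, hq]
        exact aedisjoint_intShift_add _ (hbase d hd e he hde)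
      · have h1 := ih _ _ (h.abs_quotVec_le fun i => by exact_mod_cast hk i)
          (h.abs_quotVec_le fun i => by exact_mod_cast hl i) hq
        refine measure_mono_null (t := L '' (intShift T (quotVec L k) ∩ intShift T (quotVec L l)))
          (fun x hx => ⟨L.symm x, ⟨?_, ?_⟩, by simp⟩) ?_
        · exact href k _ (by simpa using hx.1)
        · exact href l _ (by simpa using hx.2)
        · rw [h.volume_image, h1, mul_zero]
  have hdis' : Pairwise (Function.onFun (AEDisjoint volume) (intShift T)) := by
    intro k l hkl
    obtain ⟨N, hN⟩ := (Set.finite_range fun i => max (k i).natAbs (l i).natAbs).bddAbove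
    refine hdis N k l (fun i => ?_) (fun i => ?_) hkl <;>
    · have := hN ⟨i, rfl⟩
      simp only at this
      rw [Int.abs_eq_natAbs]
      omega
  exact ⟨T, hTc, hcov, fun m => ⟨_, href m⟩, hdis', volume_eq_one_of_tiling hTm hcov hdis'⟩

end LatticeTile

/-! ### Spaces of functions constant on dilated tiles. -/

section Haar

open Filter Topology Set

variable {n : ℕ}

/-- `f` is almost everywhere constant on `S`. -/
def AEConstOn (f : (Fin n → ℝ) → ℂ) (S : Set (Fin n → ℝ)) : Prop :=
  ∃ c : ℂ, ∀ᵐ x, x ∈ S → f x = c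

theorem AEConstOn.mono {f : (Fin n → ℝ) → ℂ} {S S' : Set (Fin n → ℝ)} (h : AEConstOn f S)
    (hS : S' ⊆ S) : AEConstOn f S' := by
  obtain ⟨c, hc⟩ := h
  exact ⟨c, hc.mono fun x hx hxS => hx (hS hxS)⟩

theorem AEConstOn.congr {f g : (Fin n → ℝ) → ℂ} {S : Set (Fin n → ℝ)} (h : AEConstOn f S)
    (hfg : f =ᵐ[volume] g) : AEConstOn g S := by
  obtain ⟨c, hc⟩ := h
  refine ⟨c, ?_⟩
  filter_upwards [hc, hfg] with x hx hxg hxS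
  rw [← hxg, hx hxS]

theorem AEConstOn.comp {f : (Fin n → ℝ) → ℂ} {S : Set (Fin n → ℝ)} (h : AEConstOn f S)
    {T : (Fin n → ℝ) → Fin n → ℝ} (hT : Measure.QuasiMeasurePreserving T volume volume) :
    AEConstOn (fun x => f (T x)) (T ⁻¹' S) := by
  obtain ⟨c, hc⟩ := h
  exact ⟨c, hT.ae hc⟩

theorem exists_mem_of_ae_of_measure_ne_zero {α : Type*} [MeasurableSpace α] {μ : Measure α}
    {p : α → Prop} {S : Set α} (hp : ∀ᵐ x ∂μ, p x) (hS : μ S ≠ 0) : ∃ x ∈ S, p x := by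
  by_contra! h
  exact hS (measure_mono_null (fun x hx => h x hx) hp)

/-- An L² limit is an a.e. limit along a subsequence. Positive measure of S provides one good point
at which all the constants are read off, so the constants converge too. -/
theorem isClosed_aeConstOn {S : Set (Fin n → ℝ)} (hS : volume S ≠ 0) :
    IsClosed {f : L2Space n | AEConstOn f S} := by
  refine IsSeqClosed.isClosed fun f g hf hfg => ?_
  choose c hc using hf
  obtain ⟨ns, -, hns⟩ := (tendstoInMeasure_of_tendsto_Lp hfg).exists_seq_tendsto_ae
  have h1 : ∀ᵐ x, ∀ i, x ∈ S → f i x = c i := ae_all_iff.2 hc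
  obtain ⟨x₀, hx₀, h2, h3⟩ := exists_mem_of_ae_of_measure_ne_zero (h1.and hns) hS
  refine ⟨g x₀, ?_⟩
  filter_upwards [h1, hns] with x hx hxl hxS
  refine tendsto_nhds_unique hxl ?_
  simp_rw [fun i => hx i hxS]
  simpa only [fun i => h2 i hx₀] using h3

theorem memLp_comp_continuousLinearEquiv {f : (Fin n → ℝ) → ℂ} (hf : MemLp f 2 volume)
    (L : (Fin n → ℝ) ≃L[ℝ] (Fin n → ℝ)) : MemLp (fun x => f (L x)) 2 volume := by
  have hdet : LinearMap.det (L : (Fin n → ℝ) →ₗ[ℝ] (Fin n → ℝ)) ≠ 0 :=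
    (LinearEquiv.isUnit_det' L.toLinearEquiv).ne_zero
  have h1 : Measure.map L volume = _ :=
    Measure.map_linearMap_addHaar_eq_smul_addHaar (volume : Measure (Fin n → ℝ)) hdet
  refine MemLp.comp_of_map ?_ L.continuous.measurable.aemeasurable
  rw [h1]
  exact hf.smul_measure ENNReal.ofReal_ne_top

theorem quasiMeasurePreserving_continuousLinearEquiv (L : (Fin n → ℝ) ≃L[ℝ] (Fin n → ℝ)) :
    Measure.QuasiMeasurePreserving L volume volume :=
  Measure.LinearMap.quasiMeasurePreserving volume (L : (Fin n → ℝ) →ₗ[ℝ] (Fin n → ℝ))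
    (LinearEquiv.isUnit_det' L.toLinearEquiv).ne_zero

/-- The `k`-th tile of the `j`-th dilate of the tiling by integer translates of `T`. -/
def piece (L : (Fin n → ℝ) ≃L[ℝ] (Fin n → ℝ)) (T : Set (Fin n → ℝ)) (j : ℤ) (k : Fin n → ℤ) :
    Set (Fin n → ℝ) := (L ^ j : (Fin n → ℝ) ≃L[ℝ] (Fin n → ℝ)) ⁻¹' intShift T k

/-- The square integrable functions which are almost everywhere constant on the tiles of the `j`-th
dilate of the tiling by integer translates of `T`. -/
def haarSpace (L : (Fin n → ℝ) ≃L[ℝ] (Fin n → ℝ)) (T : Set (Fin n → ℝ)) (j : ℤ) :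
    Submodule ℂ (L2Space n) where
  carrier := {f | ∀ k, AEConstOn f (piece L T j k)}
  add_mem' := by
    intro f g hf hg k
    obtain ⟨c, hc⟩ := hf k
    obtain ⟨d, hd⟩ := hg k
    refine ⟨c + d, ?_⟩
    filter_upwards [hc, hd, Lp.coeFn_add f g] with x hx hx' h hxS
    rw [h, Pi.add_apply, hx hxS, hx' hxS]
  zero_mem' := fun k => ⟨0, by
    filter_upwards [Lp.coeFn_zero ℂ 2 (volume : Measure (Fin n → ℝ))] with x hx _
    rw [hx, Pi.zero_apply]⟩
  smul_mem' := by
    intro a f hf k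
    obtain ⟨c, hc⟩ := hf k
    refine ⟨a * c, ?_⟩
    filter_upwards [hc, Lp.coeFn_smul a f] with x hx h hxS
    rw [h, Pi.smul_apply, hx hxS, smul_eq_mul]

section

variable {L : (Fin n → ℝ) ≃L[ℝ] (Fin n → ℝ)} {T : Set (Fin n → ℝ)}

theorem mem_haarSpace {j : ℤ} {f : L2Space n} :
    f ∈ haarSpace L T j ↔ ∀ k, AEConstOn f (piece L T j k) := Iff.rfl

theorem funMem_haarSpace {j : ℤ} {f : (Fin n → ℝ) → ℂ} :
    FunMem f (haarSpace L T j) ↔ MemLp f 2 volume ∧ ∀ k, AEConstOn f (piece L T j k) := by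
  constructor
  · rintro ⟨hf, h⟩
    exact ⟨hf, fun k => (h k).congr hf.coeFn_toLp⟩
  · rintro ⟨hf, h⟩
    exact ⟨hf, fun k => (h k).congr hf.coeFn_toLp.symm⟩

theorem piece_zero (k : Fin n → ℤ) : piece L T 0 k = intShift T k := by
  rw [piece, zpow_zero]; rfl

theorem piece_add_one (j : ℤ) (k : Fin n → ℤ) : piece L T (j + 1) k = L ⁻¹' piece L T j k := by
  rw [piece, zpow_add_one]; rfl

namespace IsRefinableTile

theorem measurableSet_intShift (hT : IsRefinableTile L T) (k : Fin n → ℤ) :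
    MeasurableSet (intShift T k) :=
  _root_.measurableSet_intShift hT.isCompact.isClosed.measurableSet k

theorem measurableSet_piece (hT : IsRefinableTile L T) (j : ℤ) (k : Fin n → ℤ) :
    MeasurableSet (piece L T j k) :=
  (L ^ j : (Fin n → ℝ) ≃L[ℝ] (Fin n → ℝ)).continuous.measurable (hT.measurableSet_intShift k)

theorem exists_mem_piece (hT : IsRefinableTile L T) (j : ℤ) (x : Fin n → ℝ) :
    ∃ k, x ∈ piece L T j k := hT.cover _

theorem aedisjoint_piece (hT : IsRefinableTile L T) (j : ℤ) {k l : Fin n → ℤ} (hkl : k ≠ l) :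
    AEDisjoint volume (piece L T j k) (piece L T j l) :=
  (quasiMeasurePreserving_continuousLinearEquiv _).preimage_null (hT.aedisjoint hkl)

theorem exists_piece_add_one_subset (hT : IsRefinableTile L T) (j : ℤ) (m : Fin n → ℤ) :
    ∃ k, piece L T (j + 1) m ⊆ piece L T j k := by
  obtain ⟨k, hk⟩ := hT.refines m
  refine ⟨k, fun x hx => hk _ ?_⟩
  rw [piece, add_comm, zpow_one_add] at hx
  exact hx

theorem volume_piece_ne_zero (hT : IsRefinableTile L T) (j : ℤ) (k : Fin n → ℤ) :
    volume (piece L T j k) ≠ 0 := by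
  rw [piece, Measure.addHaar_preimage_continuousLinearEquiv, volume_intShift, hT.volume_eq, mul_one,
    Ne, ENNReal.ofReal_eq_zero, not_le, abs_pos]
  exact (LinearEquiv.isUnit_det' _).ne_zero

theorem isClosed_haarSpace (hT : IsRefinableTile L T) (j : ℤ) :
    IsClosed (haarSpace L T j : Set (L2Space n)) := by
  have : (haarSpace L T j : Set (L2Space n)) = ⋂ k, {f : L2Space n | AEConstOn f (piece L T j k)} := by
    ext f; simp [mem_haarSpace]
  rw [this]
  exact isClosed_iInter fun k => isClosed_aeConstOn (hT.volume_piece_ne_zero j k)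

theorem haarSpace_le_add_one (hT : IsRefinableTile L T) (j : ℤ) :
    haarSpace L T j ≤ haarSpace L T (j + 1) := by
  intro f hf m
  obtain ⟨k, hk⟩ := hT.exists_piece_add_one_subset j m
  exact (hf k).mono hk

theorem monotone_haarSpace (hT : IsRefinableTile L T) : Monotone (haarSpace L T) :=
  monotone_int_of_le_succ hT.haarSpace_le_add_one

theorem funMem_dilation (j : ℤ) (f : (Fin n → ℝ) → ℂ) :
    FunMem f (haarSpace L T j) ↔ FunMem (fun x => f (L x)) (haarSpace L T (j + 1)) := by
  rw [funMem_haarSpace, funMem_haarSpace]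
  constructor
  · rintro ⟨hf, h⟩
    refine ⟨memLp_comp_continuousLinearEquiv hf L, fun k => ?_⟩
    rw [piece_add_one]
    exact (h k).comp (quasiMeasurePreserving_continuousLinearEquiv L)
  · rintro ⟨hf, h⟩
    refine ⟨by simpa using memLp_comp_continuousLinearEquiv hf L.symm, fun k => ?_⟩
    have h1 := (h k).comp (quasiMeasurePreserving_continuousLinearEquiv L.symm)
    rw [piece_add_one, ← preimage_comp, ContinuousLinearEquiv.self_comp_symm, preimage_id] at h1
    simpa using h1

theorem FunMem.intTranslate {f : (Fin n → ℝ) → ℂ} (h : FunMem f (haarSpace L T 0))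
    (m : Fin n → ℤ) : FunMem (intTranslate f m) (haarSpace L T 0) := by
  rw [funMem_haarSpace] at h ⊢
  have hmp : MeasurePreserving (fun x : Fin n → ℝ => x - intVec m) volume volume :=
    measurePreserving_sub_right volume _
  refine ⟨h.1.comp_measurePreserving hmp, fun k => ?_⟩
  have h1 := (h.2 (k - m)).comp hmp.quasiMeasurePreserving
  refine h1.mono fun x hx => ?_
  rw [piece_zero] at hx
  rw [mem_preimage, piece_zero]
  simpa [intShift, intVec_sub] using hx

theorem funMem_translation (f : (Fin n → ℝ) → ℂ) (m : Fin n → ℤ) :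
    FunMem f (haarSpace L T 0) ↔ FunMem (_root_.intTranslate f m) (haarSpace L T 0) := by
  refine ⟨fun h => FunMem.intTranslate h m, fun h => ?_⟩
  have h1 := FunMem.intTranslate h (-m)
  convert h1 using 1
  ext x
  simp [_root_.intTranslate]

/-- A union of tiles of the `j`-th dilated tiling has its characteristic function in the `j`-th
space. -/
theorem indicatorConstLp_mem_haarSpace (hT : IsRefinableTile L T) {j : ℤ}
    {I : Set (Fin n → ℤ)} {K : Set (Fin n → ℝ)} (hK : K = ⋃ k ∈ I, piece L T j k)
    (hKm : MeasurableSet K) (hKv : volume K ≠ ⊤) :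
    indicatorConstLp 2 hKm hKv (1 : ℂ) ∈ haarSpace L T j := by
  intro l
  have h1 := indicatorConstLp_coeFn (p := 2) (hs := hKm) (hμs := hKv) (c := (1 : ℂ))
  by_cases hl : l ∈ I
  · refine ⟨1, ?_⟩
    filter_upwards [h1] with x hx hxl
    have : x ∈ K := hK ▸ mem_iUnion₂.2 ⟨l, hl, hxl⟩
    rw [hx, indicator_of_mem this]
  · refine ⟨0, ?_⟩
    -- A tile outside the union still meets it on tile boundaries; countably many null overlaps are
    -- discarded.
    have h2 : ∀ᵐ x, ∀ k ∈ I, ¬ (x ∈ piece L T j k ∧ x ∈ piece L T j l) := by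
      rw [ae_all_iff]
      intro k
      by_cases hk : k ∈ I
      · have := measure_eq_zero_iff_ae_notMem.1
          (hT.aedisjoint_piece j (k := k) (l := l) (fun h => hl (h ▸ hk)))
        exact this.mono fun x hx _ hx' => hx hx'
      · exact Eventually.of_forall fun x h => absurd h hk
    filter_upwards [h1, h2] with x hx hx' hxl
    have : x ∉ K := by
      rw [hK, mem_iUnion₂]
      rintro ⟨k, hk, hxk⟩
      exact hx' k hk ⟨hxk, hxl⟩
    rw [hx, indicator_of_notMem this]

end IsRefinableTile

end

end Haar

/-! ### The multiresolution axioms and the Haar basis. -/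

section HaarMRA

open Filter Topology Set

variable {n : ℕ} {L : (Fin n → ℝ) ≃L[ℝ] (Fin n → ℝ)} {T : Set (Fin n → ℝ)}

/-- Chebyshev's bound for a function that is constant on `S`. -/
theorem AEConstOn.enorm_sq_mul_measure_le {f : (Fin n → ℝ) → ℂ} {S : Set (Fin n → ℝ)}
    (h : AEConstOn f S) (hS : MeasurableSet S) :
    ∀ᵐ x, x ∈ S → ‖f x‖ₑ ^ (2 : ℝ) * volume S ≤ ∫⁻ y, ‖f y‖ₑ ^ (2 : ℝ) := by
  obtain ⟨c, hc⟩ := h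
  filter_upwards [hc] with x hx hxS
  rw [hx hxS]
  calc ‖c‖ₑ ^ (2 : ℝ) * volume S = ∫⁻ y in S, ‖f y‖ₑ ^ (2 : ℝ) := by
        rw [← setLIntegral_const]
        refine setLIntegral_congr_fun_ae hS ?_
        filter_upwards [hc] with y hy hyS
        rw [hy hyS]
    _ ≤ _ := setLIntegral_le_lintegral _ _

namespace IsRefinableTile

theorem volume_piece_neg {B : Matrix (Fin n) (Fin n) ℤ} (h : IsExpandingAction B L)
    (hT : IsRefinableTile L T) (N : ℕ) (k : Fin n → ℤ) :
    volume (piece L T (-(N : ℤ)) k) = (B.det.natAbs : ENNReal) ^ N := by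
  induction N with
  | zero =>
    rw [Nat.cast_zero, neg_zero, piece_zero, volume_intShift, hT.volume_eq, pow_zero]
  | succ N ih =>
    have h1 : piece L T (-((N + 1 : ℕ) : ℤ)) k = L '' piece L T (-(N : ℤ)) k := by
      have h2 := piece_add_one (L := L) (T := T) (-((N + 1 : ℕ) : ℤ)) k
      rw [show -((N + 1 : ℕ) : ℤ) + 1 = -(N : ℤ) by push_cast; ring] at h2
      rw [h2, image_preimage_eq _ L.surjective]
    rw [h1, h.volume_image, ih, pow_succ']

/-- Almost every x lies in tiles of volume |det B|^N on which f is constant, for every N. A nonzero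
value there would make the L² norm infinite, since |det B| ≥ 2. -/
theorem iInf_haarSpace {B : Matrix (Fin n) (Fin n) ℤ} (h : IsExpandingAction B L) (hn : 1 ≤ n)
    (hT : IsRefinableTile L T) : ⨅ j, haarSpace L T j = ⊥ := by
  rw [eq_bot_iff]
  intro f hf
  rw [Submodule.mem_iInf] at hf
  rw [Submodule.mem_bot, Lp.eq_zero_iff_ae_eq_zero]
  set M := ∫⁻ y, ‖f y‖ₑ ^ (2 : ℝ) with hM
  have hMfin : M < ⊤ := by
    rw [hM, ← ENNReal.toReal_ofNat 2]
    exact lintegral_rpow_enorm_lt_top_of_eLpNorm_lt_top (by norm_num) (by norm_num)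
      (Lp.memLp f).eLpNorm_lt_top
  have h1 : ∀ᵐ x, ∀ (N : ℕ) (k : Fin n → ℤ), x ∈ piece L T (-(N : ℤ)) k →
      ‖f x‖ₑ ^ (2 : ℝ) * volume (piece L T (-(N : ℤ)) k) ≤ M := by
    simp only [ae_all_iff]
    exact fun N k => ((hf (-N)) k).enorm_sq_mul_measure_le (hT.measurableSet_piece _ _)
  filter_upwards [h1] with x hx
  by_contra h0
  have h2 : ‖f x‖ₑ ^ (2 : ℝ) ≠ 0 := by
    simpa using h0
  obtain ⟨N, hN⟩ := ENNReal.exists_nat_mul_gt h2 hMfin.ne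
  obtain ⟨k, hk⟩ := hT.exists_mem_piece (-(N : ℤ)) x
  have h3 := hx N k hk
  rw [volume_piece_neg h hT] at h3
  have h4 : N ≤ B.det.natAbs ^ N :=
    (Nat.lt_pow_self (h.two_le_natAbs_det hn)).le
  have h5 : (N : ENNReal) ≤ (B.det.natAbs : ENNReal) ^ N := by exact_mod_cast h4
  refine absurd (hN.trans_le ?_) (lt_irrefl M)
  calc (N : ENNReal) * ‖f x‖ₑ ^ (2 : ℝ) ≤ (B.det.natAbs : ENNReal) ^ N * ‖f x‖ₑ ^ (2 : ℝ) := by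
        gcongr
    _ ≤ M := by rwa [mul_comm]

theorem exists_dist_le_of_mem_piece {B : Matrix (Fin n) (Fin n) ℤ} (h : IsExpandingAction B L)
    (hT : IsRefinableTile L T) :
    ∃ R : ℝ, 0 ≤ R ∧ ∀ (N : ℕ) (k : Fin n → ℤ), ∀ x ∈ piece L T N k, ∀ y ∈ piece L T N k,
      dist x y ≤ (1 / 3) ^ N * R := by
  refine ⟨Metric.diam T, Metric.diam_nonneg, fun N => ?_⟩
  induction N with
  | zero =>
    intro k x hx y hy
    rw [Nat.cast_zero, piece_zero] at hx hy
    have h1 := Metric.dist_le_diam_of_mem hT.isCompact.isBounded hx hy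
    rw [dist_sub_right] at h1
    simpa using h1
  | succ N ih =>
    intro k x hx y hy
    rw [Nat.cast_add, Nat.cast_one, piece_add_one] at hx hy
    have h1 := ih k _ hx _ hy
    have h2 := h.expand (x - y)
    rw [map_sub, ← dist_eq_norm, ← dist_eq_norm] at h2
    rw [pow_succ]
    linarith

/-- K is approximated from outside by the union of the level-N tiles meeting it. The indicator of
that union lies in the N-th space, so g integrates to 0 over it, and dominated convergence passes to
K. -/
theorem setIntegral_eq_zero {B : Matrix (Fin n) (Fin n) ℤ} (h : IsExpandingAction B L)
    (hT : IsRefinableTile L T) {g : L2Space n} (hg : ∀ j, g ∈ (haarSpace L T j)ᗮ)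
    {K : Set (Fin n → ℝ)} (hK : IsCompact K) : ∫ x in K, g x = 0 := by
  obtain ⟨R, hR0, hR⟩ := exists_dist_le_of_mem_piece h hT
  let I : ℕ → Set (Fin n → ℤ) := fun N => {k | (piece L T N k ∩ K).Nonempty}
  let KN : ℕ → Set (Fin n → ℝ) := fun N => ⋃ k ∈ I N, piece L T N k
  have hKm : ∀ N, MeasurableSet (KN N) := fun N =>
    MeasurableSet.biUnion (to_countable _) fun k _ => hT.measurableSet_piece _ k
  have hsub : ∀ N, K ⊆ KN N := fun N x hx => by
    obtain ⟨k, hk⟩ := hT.exists_mem_piece N x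
    exact mem_iUnion₂.2 ⟨k, ⟨x, hk, hx⟩, hk⟩
  have hdist : ∀ N, ∀ x ∈ KN N, ∃ y ∈ K, dist x y ≤ (1 / 3) ^ N * R := by
    intro N x hx
    obtain ⟨k, ⟨y, hy, hyK⟩, hxk⟩ := mem_iUnion₂.1 hx
    exact ⟨y, hyK, hR N k x hxk y hy⟩
  -- A single compact set containing all the approximations: g is integrable on it, which gives the
  -- dominating function.
  set K' := Metric.cthickening R K with hK'
  have hK'c : IsCompact K' := hK.cthickening
  have hKN' : ∀ N, KN N ⊆ K' := by
    intro N x hx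
    obtain ⟨y, hy, hxy⟩ := hdist N x hx
    refine Metric.mem_cthickening_of_dist_le x y R K hy (hxy.trans ?_)
    exact mul_le_of_le_one_left hR0 (pow_le_one₀ (by norm_num) (by norm_num))
  have hfin : ∀ N, volume (KN N) ≠ ⊤ := fun N =>
    ((measure_mono (hKN' N)).trans_lt hK'c.measure_lt_top).ne
  have hzero : ∀ N, ∫ x in KN N, g x = 0 := by
    intro N
    rw [← L2.inner_indicatorConstLp_one (𝕜 := ℂ) (hKm N) (hfin N) g]
    exact (Submodule.mem_orthogonal _ _).1 (hg N) _
      (hT.indicatorConstLp_mem_haarSpace (j := N) rfl (hKm N) (hfin N))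
  have hint : IntegrableOn g K' :=
    ((Lp.memLp g).locallyIntegrable (by norm_num)).integrableOn_isCompact hK'c
  have hlim : Tendsto (fun N => ∫ x, (KN N).indicator g x) atTop (𝓝 (∫ x, K.indicator g x)) := by
    refine tendsto_integral_of_dominated_convergence (K'.indicator fun x => ‖g x‖)
      (fun N => (Lp.aestronglyMeasurable g).indicator (hKm N))
      (IntegrableOn.integrable_indicator hint.norm hK'c.isClosed.measurableSet)
      (fun N => Eventually.of_forall fun x => ?_) (Eventually.of_forall fun x => ?_)
    · rw [norm_indicator_eq_indicator_norm]
      exact indicator_le_indicator_of_subset (hKN' N) (fun _ => norm_nonneg _) x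
    · by_cases hx : x ∈ K
      · simp only [indicator_of_mem hx, indicator_of_mem (hsub _ hx)]
        exact tendsto_const_nhds
      · obtain ⟨ε, hε, hball⟩ := Metric.isOpen_iff.1 hK.isClosed.isOpen_compl x hx
        have h1 : Tendsto (fun N : ℕ => (1 / 3 : ℝ) ^ N * R) atTop (𝓝 0) := by
          simpa using (tendsto_pow_atTop_nhds_zero_of_lt_one (r := (1 / 3 : ℝ)) (by norm_num)
            (by norm_num)).mul_const R
        refine tendsto_const_nhds.congr' ?_
        filter_upwards [h1.eventually_lt_const hε] with N hN
        have h2 : x ∉ KN N := by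
          intro hxN
          obtain ⟨y, hy, hxy⟩ := hdist N x hxN
          exact hball (Metric.mem_ball'.2 (hxy.trans_lt hN)) hy
        rw [indicator_of_notMem hx, indicator_of_notMem h2]
  simp only [integral_indicator (hKm _), hzero,
    integral_indicator hK.isClosed.measurableSet] at hlim
  exact (tendsto_nhds_unique hlim tendsto_const_nhds)

/-- By nesting, the union is a subspace, so density amounts to a trivial orthogonal complement; a
function with zero integral over every compact set vanishes a.e. -/
theorem closure_iUnion_haarSpace {B : Matrix (Fin n) (Fin n) ℤ} (h : IsExpandingAction B L)
    (hT : IsRefinableTile L T) :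
    closure (⋃ j, (haarSpace L T j : Set (L2Space n))) = univ := by
  have h1 : ((⨆ j, haarSpace L T j : Submodule ℂ (L2Space n)) : Set (L2Space n))
      = ⋃ j, (haarSpace L T j : Set (L2Space n)) :=
    Submodule.coe_iSup_of_directed _ hT.monotone_haarSpace.directed_le
  have h2 : (⨆ j, haarSpace L T j : Submodule ℂ (L2Space n)).topologicalClosure = ⊤ := by
    rw [Submodule.topologicalClosure_eq_top_iff, eq_bot_iff]
    intro g hg
    rw [Submodule.mem_bot, Lp.eq_zero_iff_ae_eq_zero]
    refine ae_eq_zero_of_forall_setIntegral_isCompact_eq_zero'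
      ((Lp.memLp g).locallyIntegrable (by norm_num)) fun K hK => setIntegral_eq_zero h hT ?_ hK
    exact fun j => Submodule.orthogonal_le (le_iSup (haarSpace L T) j) hg
  rw [← h1, ← Submodule.topologicalClosure_coe, h2, Submodule.top_coe]

theorem volume_intShift_ne_top (hT : IsRefinableTile L T) (k : Fin n → ℤ) :
    volume (intShift T k) ≠ ⊤ := by
  rw [volume_intShift, hT.volume_eq]; exact ENNReal.one_ne_top

/-- The characteristic function of an integer translate of the tile, in the Haar space. -/
noncomputable def haarBasisVector (hT : IsRefinableTile L T) (k : Fin n → ℤ) : haarSpace L T 0 :=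
  ⟨indicatorConstLp 2 (hT.measurableSet_intShift k) (hT.volume_intShift_ne_top k) 1,
    hT.indicatorConstLp_mem_haarSpace (I := {k}) (by simp [piece_zero]) _ _⟩

theorem inner_haarBasisVector (hT : IsRefinableTile L T) (k : Fin n → ℤ) (f : haarSpace L T 0) :
    inner ℂ (hT.haarBasisVector k) f = ∫ x in intShift T k, (f : L2Space n) x :=
  L2.inner_indicatorConstLp_one (hT.measurableSet_intShift k) (hT.volume_intShift_ne_top k) _

theorem orthonormal_haarBasisVector (hT : IsRefinableTile L T) :
    Orthonormal ℂ hT.haarBasisVector := by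
  rw [orthonormal_iff_ite]
  intro k l
  rw [inner_haarBasisVector, haarBasisVector,
    integral_congr_ae (ae_restrict_of_ae indicatorConstLp_coeFn),
    setIntegral_indicator (hT.measurableSet_intShift l), setIntegral_const, measureReal_def]
  split_ifs with hkl
  · subst hkl
    rw [inter_self, volume_intShift, hT.volume_eq]
    simp
  · rw [show volume (intShift T k ∩ intShift T l) = 0 from hT.aedisjoint hkl]
    simp

/-- As tiles have measure 1, the inner product with the k-th indicator is exactly the constant value
on the k-th tile; if all vanish, so does f, because the tiles cover. -/
theorem orthogonal_span_haarBasisVector (hT : IsRefinableTile L T) :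
    (Submodule.span ℂ (range hT.haarBasisVector))ᗮ = ⊥ := by
  rw [eq_bot_iff]
  intro f hf
  rw [Submodule.mem_bot, ← Submodule.coe_eq_zero, Lp.eq_zero_iff_ae_eq_zero]
  have h1 : ∀ᵐ x, ∀ k, x ∈ intShift T k → (f : L2Space n) x = 0 := by
    rw [ae_all_iff]
    intro k
    have h2 := (Submodule.mem_orthogonal _ _).1 hf _ (Submodule.subset_span ⟨k, rfl⟩)
    obtain ⟨c, hc⟩ := f.2 k
    rw [piece_zero] at hc
    rw [inner_haarBasisVector, setIntegral_congr_ae (g := fun _ => c)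
      (hT.measurableSet_intShift k) hc, setIntegral_const, measureReal_def, volume_intShift,
      hT.volume_eq, ENNReal.toReal_one, one_smul] at h2
    simpa [h2] using hc
  filter_upwards [h1] with x hx
  obtain ⟨k, hk⟩ := hT.cover x
  exact hx k hk

theorem isScalingFunction (hT : IsRefinableTile L T) :
    IsScalingFunction (haarSpace L T 0) (T.indicator fun _ => 1) := by
  have : CompleteSpace (haarSpace L T 0) := (hT.isClosed_haarSpace 0).completeSpace_coe
  refine ⟨HilbertBasis.mkOfOrthogonalEqBot hT.orthonormal_haarBasisVector
    hT.orthogonal_span_haarBasisVector, fun k => ?_⟩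
  rw [HilbertBasis.coe_mkOfOrthogonalEqBot]
  -- The integer translate of the indicator of T is definitionally the indicator of `intShift T k`.
  exact indicatorConstLp_coeFn (hs := hT.measurableSet_intShift k)
    (hμs := hT.volume_intShift_ne_top k)

theorem isMRA {B : Matrix (Fin n) (Fin n) ℤ} (h : IsExpandingAction B L) (hn : 1 ≤ n)
    (hT : IsRefinableTile L T) : IsMRA B (haarSpace L T) where
  isClosed := hT.isClosed_haarSpace
  nested := hT.haarSpace_le_add_one
  dense := closure_iUnion_haarSpace h hT
  inter := iInf_haarSpace h hn hT
  dilation j f := by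
    simp_rw [← h.apply_eq]
    exact funMem_dilation j f
  translation := funMem_translation
  exists_scaling := ⟨_, hT.isScalingFunction⟩

end IsRefinableTile

end HaarMRA

theorem mainTheorem4 (n : ℕ) (hn : 1 ≤ n) (A : Matrix (Fin n) (Fin n) ℤ)
    (hA : IsDilationMatrix A) :
    ∃ β : ℕ, 1 ≤ β ∧ ∀ k : ℕ, β ≤ k →
      IsDilationMatrix (A ^ k) ∧
      (∀ i : Fin n, 2 < (Matrix.toEuclideanLin
        ((A ^ k).map (Int.cast : ℤ → ℝ))).singularValues i) ∧
      ∃ V : ℤ → Submodule ℂ (L2Space n), IsMRA (A ^ k) V ∧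
        ∃ φ : (Fin n → ℝ) → ℂ, IsScalingFunction (V 0) φ ∧ IsHaarLike φ := by
  obtain ⟨β, hβ1, hβ⟩ := hA.exists_pow_expanding hn
  refine ⟨β, hβ1, fun k hk => ?_⟩
  obtain ⟨hsup, heuc⟩ := hβ k hk
  obtain ⟨L, hL⟩ := exists_isExpandingAction hsup
  obtain ⟨T, hT⟩ := hL.exists_isRefinableTile
  refine ⟨hA.pow (by omega), fun i => ?_, haarSpace L T, hT.isMRA hL hn, _, hT.isScalingFunction,
    T, hT.isCompact.isClosed.measurableSet, rfl⟩
  refine LinearMap.lt_singularValues _ (fun x hx => ?_) (by simp)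
  have h1 := heuc x
  have h2 := norm_pos_iff.2 hx
  linarith
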